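/- Let $C=\{1,\dots,k\}$ be a set of $k$ colors. An instance consists of a finite simple graph $G$, a list $L(v)\subseteq C$ for every vertex $v$, and two $L$-colorings $f_0,f_r$ of $G$, where an $L$-coloring is a map $f\colon V(G)\to C$ with $f(v)\in L(v)$ for all $v$ and $f(v)\ne f(w)$ for every edge $vw$. A reconfiguration sequence of length $\ell$ between $f_0$ and $f_r$ is a sequence of $L$-colorings $g_0=f_0,g_1,\dots,g_\ell=f_r$ in which $g_{i-1}$ and $g_i$ differ at exactly one vertex, for $1\le i\le\ell$. The problem List Coloring Shortest Reconfiguration asks for the minimum length of such a sequence, or for the answer that there is none (length $+\infty$). **Theorem.** List Coloring Shortest Reconfiguration is fixed-parameter tractable when parameterized by $k+\mathsf{vc}$, where $\mathsf{vc}$ is an upper bound on the size of a minimum vertex cover of $G$. That is, there are an algorithm, a computable function $F\colon\mathbb N\to\mathbb N$ and a constant $c$ such that the algorithm solves every instance $x$ in at most $F(k+\mathsf{vc})\cdot|x|^{c}$ steps, where $|x|$ is the length of the encoding of $x$. -/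

import Mathlib

/-! ### Random access machines with a step count

A random access machine has registers `0, 1, 2, …` and arrays `0, 1, 2, …` of cells, all
holding natural numbers (a program mentions only finitely many of them by name).  Programs are
structured programs over the usual elementary instructions.  Every elementary instruction and
every test costs one step.  The only arithmetic is addition and truncated subtraction, so the
bit length of the largest number grows by at most one per step: unit cost is polynomially
equivalent to Turing machine time. -/

namespace Ram

/-- Programs.  `x`, `y`, `z` are names of registers and `a` is the name of an array. -/
inductive Prog : Type
  /-- `x := n` for a constant `n` -/
  | const (x n : ℕ) : Prog
  /-- `x := y + z` -/
  | add (x y z : ℕ) : Prog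
  /-- `x := y - z` (zero if `y < z`) -/
  | sub (x y z : ℕ) : Prog
  /-- `x := a[y]` -/
  | load (x a y : ℕ) : Prog
  /-- `a[x] := y` -/
  | store (a x y : ℕ) : Prog
  /-- `p; q` -/
  | seq (p q : Prog) : Prog
  /-- `if x ≠ 0 then p else q` -/
  | ite (x : ℕ) (p q : Prog) : Prog
  /-- `while x ≠ 0 do p` -/
  | loop (x : ℕ) (p : Prog) : Prog

/-- The contents of the registers and of the array cells. -/
@[ext]
structure State : Type where
  reg : ℕ → ℕ
  arr : ℕ → ℕ → ℕ

/-- The state with register `x` set to `n`. -/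
def State.setReg (s : State) (x n : ℕ) : State :=
  { s with reg := Function.update s.reg x n }

/-- The state with cell `i` of array `a` set to `n`. -/
def State.setCell (s : State) (a i n : ℕ) : State :=
  { s with arr := Function.update s.arr a (Function.update (s.arr a) i n) }

/-- `Exec p s t s'`: the program `p`, started in state `s`, halts in state `s'` after exactly
`t` steps. -/
inductive Exec : Prog → State → ℕ → State → Prop
  | const (s : State) (x n : ℕ) : Exec (.const x n) s 1 (s.setReg x n)
  | add (s : State) (x y z : ℕ) : Exec (.add x y z) s 1 (s.setReg x (s.reg y + s.reg z))
  | sub (s : State) (x y z : ℕ) : Exec (.sub x y z) s 1 (s.setReg x (s.reg y - s.reg z))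
  | load (s : State) (x a y : ℕ) : Exec (.load x a y) s 1 (s.setReg x (s.arr a (s.reg y)))
  | store (s : State) (a x y : ℕ) :
      Exec (.store a x y) s 1 (s.setCell a (s.reg x) (s.reg y))
  | seq {p q : Prog} {s s' s'' : State} {t t' : ℕ} :
      Exec p s t s' → Exec q s' t' s'' → Exec (.seq p q) s (t + t') s''
  | iteTrue {x : ℕ} {p q : Prog} {s s' : State} {t : ℕ} :
      s.reg x ≠ 0 → Exec p s t s' → Exec (.ite x p q) s (t + 1) s'
  | iteFalse {x : ℕ} {p q : Prog} {s s' : State} {t : ℕ} :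
      s.reg x = 0 → Exec q s t s' → Exec (.ite x p q) s (t + 1) s'
  | loopDone {x : ℕ} {p : Prog} {s : State} :
      s.reg x = 0 → Exec (.loop x p) s 1 s
  | loopStep {x : ℕ} {p : Prog} {s s' s'' : State} {t t' : ℕ} :
      s.reg x ≠ 0 → Exec p s t s' → Exec (.loop x p) s' t' s'' →
        Exec (.loop x p) s (t + t' + 1) s''

/-- The initial state on an input: the input is in array `0`, its number of entries is in
register `0`, and everything else is zero. -/
def initial (input : List ℕ) : State where
  reg x := if x = 0 then input.length else 0
  arr a i := if a = 0 then input.getD i 0 else 0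

/-- `p` halts on `input` after exactly `t` steps with the number `out` in register `0`. -/
def HaltsWith (p : Prog) (input : List ℕ) (t out : ℕ) : Prop :=
  ∃ s : State, Exec p (initial input) t s ∧ s.reg 0 = out

/-- The length of an input: its entries are written in binary and each is followed by a
separator. -/
def inputSize (input : List ℕ) : ℕ :=
  (input.map fun m => Nat.size m + 1).sum

/-- The problem of computing `answer x` from the input `encode x`, for the instances `x : ι`, is
fixed-parameter tractable with respect to the parameter `param`: a single algorithm solves all
instances in time `f (param x) * |x| ^ c` for a computable function `f` and a constant `c`. -/
def FixedParameterTractable {ι : Type} (encode : ι → List ℕ) (answer param : ι → ℕ) : Prop :=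
  ∃ (p : Prog) (f : ℕ → ℕ) (c : ℕ), Computable f ∧
    ∀ x : ι, ∃ t : ℕ, HaltsWith p (encode x) t (answer x) ∧
      t ≤ f (param x) * inputSize (encode x) ^ c

end Ram

/-! ### List coloring reconfiguration -/

namespace ListRecoloring

/-- `f` is an `L`-coloring of `G`. -/
def IsListColoring {V C : Type} (G : SimpleGraph V) (L : V → Finset C) (f : V → C) : Prop :=
  (∀ v, f v ∈ L v) ∧ ∀ v w, G.Adj v w → f v ≠ f w

/-- Two colorings are adjacent if they differ at exactly one vertex. -/
def AdjacentColorings {V C : Type} (f g : V → C) : Prop :=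
  {v | f v ≠ g v}.ncard = 1

/-- `s 0, s 1, …, s ℓ` is a reconfiguration sequence of length `ℓ` between the `L`-colorings
`f` and `g` of `G` (the values of `s` beyond `ℓ` are irrelevant). -/
def IsReconfSeq {V C : Type} (G : SimpleGraph V) (L : V → Finset C) (f g : V → C)
    (ℓ : ℕ) (s : ℕ → V → C) : Prop :=
  s 0 = f ∧ s ℓ = g ∧ (∀ i ≤ ℓ, IsListColoring G L (s i)) ∧
    ∀ i < ℓ, AdjacentColorings (s i) (s (i + 1))

/-- The length of a shortest reconfiguration sequence between `f` and `g`; it is `⊤` if there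
is no reconfiguration sequence. -/
noncomputable def shortestLength {V C : Type} (G : SimpleGraph V) (L : V → Finset C)
    (f g : V → C) : ℕ∞ :=
  ⨅ (ℓ : ℕ) (_ : ∃ s, IsReconfSeq G L f g ℓ s), (ℓ : ℕ∞)

/-- An instance of list coloring (shortest) reconfiguration: a simple graph with vertices
`0, …, n - 1`, a list of colors from the color set `{0, …, k - 1}` for each vertex, and an
initial and a target list coloring. -/
structure Instance : Type where
  n : ℕ
  k : ℕ
  graph : SimpleGraph (Fin n)
  list : Fin n → Finset (Fin k)
  ini : Fin n → Fin k
  tar : Fin n → Fin k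
  ini_coloring : IsListColoring graph list ini
  tar_coloring : IsListColoring graph list tar

open Classical in
/-- The encoding of an instance: `n`, `k`, the `n × n` adjacency matrix row by row, the
`n × k` vertex-color incidence matrix of the lists row by row, and the two colorings. -/
noncomputable def Instance.encode (I : Instance) : List ℕ :=
  [I.n, I.k]
    ++ List.ofFn (fun e : Fin (I.n * I.n) => if I.graph.Adj e.divNat e.modNat then 1 else 0)
    ++ List.ofFn (fun e : Fin (I.n * I.k) => if e.modNat ∈ I.list e.divNat then 1 else 0)
    ++ List.ofFn (fun v => (I.ini v : ℕ))
    ++ List.ofFn (fun v => (I.tar v : ℕ))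

/-- The shortest length of an instance. -/
noncomputable def Instance.opt (I : Instance) : ℕ∞ :=
  shortestLength I.graph I.list I.ini I.tar

/-- The answer as a number: `0` for a no-instance, and `ℓ + 1` if the shortest length is `ℓ`. -/
noncomputable def Instance.answer (I : Instance) : ℕ :=
  ENat.recTopCoe 0 (fun ℓ => ℓ + 1) I.opt

/-- An instance together with an upper bound `vc` on the size of a minimum vertex cover of its
graph. -/
structure BoundedInstance : Type extends Instance where
  vc : ℕ
  cover_le : graph.vertexCoverNum ≤ vc

end ListRecoloring

/-! Call two vertices twins if they have the same list, the same neighbors, and the same initial and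
target colors. A vertex outside a vertex cover has all its neighbors in the cover, so the number of
twin classes is bounded in terms of `k + vc` (`numClasses_le`).

The core is an exchange argument (`exists_isWalk`). Given a reconfiguration sequence, pick in each
class a member that is recolored least often and let the whole class copy its moves. The colorings
stay proper, the endpoints do not change, and the total number of recolorings does not grow.
Conversely, twins are never adjacent, so recoloring a class at once can be carried out vertex by
vertex (`IsWalk.reconfigurable`). The shortest length is therefore the least weight of a walk on the
colorings that are constant on classes, where a step weighs the number of vertices that change.

There are at most `K = k ^ numClasses` such colorings. Cutting out cycles and padding with
stationary steps of weight zero gives walks with exactly `K` steps (`exists_short_walk`), and such a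
walk is a number below `K ^ (K + 1)`. Exhaustive search over these numbers finds the answer
(`answer_eq`).

For the running time, the search is a term of a small language with bounded loops. If no loop makes
more than `B` iterations, the compiled term runs in `cst * B ^ deg` steps (`Computes.result`). Here
`B` can be the input size times a computable function of `k + vc`, so the power splits as required.
-/

namespace Ram

/-! ### A language of arithmetic terms and its compilation to random access machines -/

/-- Arithmetic terms over an input array.  The variables are de Bruijn indices. -/
inductive Term : Type
  | const (n : ℕ) : Term
  | var (i : ℕ) : Term
  | add (a b : Term) : Term
  | sub (a b : Term) : Term
  /-- the input entry with index `a` -/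
  | read (a : Term) : Term
  /-- the term `a` without access to the innermost variable -/
  | wk (a : Term) : Term
  /-- the result of `b` iterations of `step`, starting from `init`; in `step`, variable `0` is the
  number of the iteration and variable `1` is the current value -/
  | loop (b init step : Term) : Term

namespace Term

/-- The program that computes a term into register `d`, using registers above `d` as temporary
ones.  The variables are kept in the registers `ρ`. -/
def compile : Term → List ℕ → ℕ → Prog
  | const n, _, d => .const d n
  | var i, ρ, d => match ρ[i]? with
    | none => .const d 0
    | some r => .seq (.const d 0) (.add d r d)
  | add a b, ρ, d => .seq (a.compile ρ d) (.seq (b.compile ρ (d + 1)) (.add d d (d + 1)))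
  | sub a b, ρ, d => .seq (a.compile ρ d) (.seq (b.compile ρ (d + 1)) (.sub d d (d + 1)))
  | read a, ρ, d => .seq (a.compile ρ d) (.load d 0 d)
  | wk a, ρ, d => a.compile ρ.tail d
  | loop b init step, ρ, d =>
    .seq (init.compile ρ d) (.seq (b.compile ρ (d + 1)) (.seq (.const (d + 2) 0)
      (.loop (d + 1) (.seq (step.compile ((d + 2) :: d :: ρ) (d + 3))
        (.seq (.const d 0) (.seq (.add d d (d + 3)) (.seq (.const (d + 3) 1)
          (.seq (.sub (d + 1) (d + 1) (d + 3)) (.add (d + 2) (d + 2) (d + 3))))))))))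

/-- The constant factor of the running time of a term. -/
def cst : Term → ℕ
  | const _ => 1
  | var _ => 2
  | add a b => a.cst + b.cst + 1
  | sub a b => a.cst + b.cst + 1
  | read a => a.cst + 1
  | wk a => a.cst
  | loop b init step => b.cst + init.cst + step.cst + 8

/-- The degree of the running time of a term. -/
def deg : Term → ℕ
  | const _ => 0
  | var _ => 0
  | add a b => a.deg + b.deg
  | sub a b => a.deg + b.deg
  | read a => a.deg
  | wk a => a.deg
  | loop b init step => b.deg + init.deg + step.deg + 1

end Term

/-- `Computes inp B env e v`: the term `e` has the value `v` in the environment `env`, and no loop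
of its evaluation has more than `B` iterations. -/
inductive Computes (inp : ℕ → ℕ) (B : ℕ) : List ℕ → Term → ℕ → Prop
  | const {env : List ℕ} (n : ℕ) : Computes inp B env (.const n) n
  | var {env : List ℕ} (i : ℕ) : Computes inp B env (.var i) (env.getD i 0)
  | add {env : List ℕ} {a b : Term} {x y : ℕ} :
      Computes inp B env a x → Computes inp B env b y → Computes inp B env (.add a b) (x + y)
  | sub {env : List ℕ} {a b : Term} {x y : ℕ} :
      Computes inp B env a x → Computes inp B env b y → Computes inp B env (.sub a b) (x - y)
  | read {env : List ℕ} {a : Term} {x : ℕ} :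
      Computes inp B env a x → Computes inp B env (.read a) (inp x)
  | wk {env : List ℕ} {a : Term} {x : ℕ} :
      Computes inp B env.tail a x → Computes inp B env (.wk a) x
  | loop {env : List ℕ} {b init step : Term} {n : ℕ} (f : ℕ → ℕ) :
      Computes inp B env b n → n ≤ B → Computes inp B env init (f 0) →
      (∀ i < n, Computes inp B (i :: f i :: env) step (f (i + 1))) →
      Computes inp B env (.loop b init step) (f n)

/-- `Result s d v t p`: started in `s`, the program `p` halts within `t` steps with `v` in register
`d`, and it leaves the lower registers and the arrays unchanged. -/
def Result (s : State) (d v t : ℕ) (p : Prog) : Prop :=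
  ∃ t' s', Exec p s t' s' ∧ t' ≤ t ∧ s'.reg d = v ∧ (∀ r < d, s'.reg r = s.reg r) ∧ s'.arr = s.arr

theorem map_reg_congr {ρ : List ℕ} {d : ℕ} {s s' : State} (hρ : ∀ r ∈ ρ, r < d)
    (h : ∀ r < d, s'.reg r = s.reg r) : ρ.map s'.reg = ρ.map s.reg :=
  List.map_congr_left fun r hr => h r (hρ r hr)

/-- A loop that counts register `d + 1` down and register `d + 2` up iterates the function that
its body computes in register `d`. -/
theorem exec_loop {x d : ℕ} {p : Prog} {f : ℕ → ℕ} {T n : ℕ} {s₀ : State} (hx : x = d + 1)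
    (hstep : ∀ s i, i < n → s.reg d = f i → s.reg (d + 2) = i → s.reg (d + 1) = n - i →
      (∀ r < d, s.reg r = s₀.reg r) → s.arr = s₀.arr →
      ∃ t s', Exec p s t s' ∧ t ≤ T ∧ s'.reg d = f (i + 1) ∧ s'.reg (d + 2) = i + 1 ∧
        s'.reg (d + 1) = n - (i + 1) ∧ (∀ r < d, s'.reg r = s₀.reg r) ∧ s'.arr = s₀.arr)
    (j : ℕ) : ∀ (s : State) (i : ℕ), i + j = n → s.reg d = f i → s.reg (d + 2) = i →
      s.reg (d + 1) = n - i → (∀ r < d, s.reg r = s₀.reg r) → s.arr = s₀.arr →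
      ∃ t s', Exec (.loop x p) s t s' ∧ t ≤ j * (T + 1) + 1 ∧ s'.reg d = f n ∧
        (∀ r < d, s'.reg r = s₀.reg r) ∧ s'.arr = s₀.arr := by
  subst hx
  induction j with
  | zero =>
    intro s i hi h1 h2 h3 h4 h5
    obtain rfl : i = n := by omega
    exact ⟨1, s, .loopDone (by omega), by omega, h1, h4, h5⟩
  | succ j ih =>
    intro s i hi h1 h2 h3 h4 h5
    obtain ⟨t, s', e, ht, g1, g2, g3, g4, g5⟩ := hstep s i (by omega) h1 h2 h3 h4 h5
    obtain ⟨t', s'', e', ht', k⟩ := ih s' (i + 1) (by omega) g1 g2 g3 g4 g5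
    refine ⟨t + t' + 1, s'', .loopStep (by omega) e e', ?_, k⟩
    rw [Nat.succ_mul]
    omega

/-- Compilation is correct, and the running time is polynomial in the number of iterations. -/
theorem Computes.result {inp : ℕ → ℕ} {B : ℕ} (hB : 1 ≤ B) {env : List ℕ} {e : Term} {v : ℕ}
    (h : Computes inp B env e v) : ∀ (ρ : List ℕ) (d : ℕ) (s : State), (∀ r ∈ ρ, r < d) →
      env = ρ.map s.reg → s.arr 0 = inp → Result s d v (e.cst * B ^ e.deg) (e.compile ρ d) := by
  have hp : ∀ {m n : ℕ}, m ≤ n → B ^ m ≤ B ^ n := fun h => Nat.pow_le_pow_right hB h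
  have hone : ∀ m, 1 ≤ B ^ m := fun m => Nat.one_le_pow _ _ hB
  induction h with
  | const n =>
    intro ρ d s hρ henv hs
    exact ⟨1, _, .const s d n, by simp [Term.cst, Term.deg], by simp [State.setReg],
      fun r hr => by simp [State.setReg, hr.ne], rfl⟩
  | var i =>
    intro ρ d s hρ henv hs
    simp only [Term.compile, Term.cst, Term.deg]
    subst henv
    rcases hi : ρ[i]? with _ | r
    · exact ⟨1, _, .const s d 0, by simp, by simp [State.setReg, hi],
        fun r hr => by simp [State.setReg, hr.ne], rfl⟩
    · have hr : r < d := hρ r (List.mem_of_getElem? hi)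
      exact ⟨2, _, .seq (.const s d 0) (.add _ d r d), by simp,
        by simp [State.setReg, hi, hr.ne], fun r hr => by simp [State.setReg, hr.ne], rfl⟩
  | @add env a b x y _ _ iha ihb =>
    intro ρ d s hρ henv hs
    obtain ⟨ta, s1, e1, l1, v1, f1, r1⟩ := iha ρ d s hρ henv hs
    obtain ⟨tb, s2, e2, l2, v2, f2, r2⟩ := ihb ρ (d + 1) s1 (fun r hr => (hρ r hr).trans (by omega))
      (henv.trans (map_reg_congr hρ f1).symm) (by rw [r1, hs])
    refine ⟨_, _, .seq e1 (.seq e2 (.add _ d d (d + 1))), ?_, ?_, ?_, ?_⟩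
    -- Since `B ≥ 1`, both running times can be raised to the common degree.
    · have h1 := Nat.mul_le_mul_left a.cst (hp (Nat.le_add_right a.deg b.deg))
      have h2 := Nat.mul_le_mul_left b.cst (hp (Nat.le_add_left b.deg a.deg))
      have h3 := hone (a.deg + b.deg)
      simp only [Term.cst, Term.deg, add_mul]
      omega
    · simp [State.setReg, v2, f2 d (by omega), v1]
    · intro r hr
      simp [State.setReg, hr.ne, f2 r (by omega), f1 r hr]
    · simp [State.setReg, r2, r1]
  | @sub env a b x y _ _ iha ihb =>
    intro ρ d s hρ henv hs
    obtain ⟨ta, s1, e1, l1, v1, f1, r1⟩ := iha ρ d s hρ henv hs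
    obtain ⟨tb, s2, e2, l2, v2, f2, r2⟩ := ihb ρ (d + 1) s1 (fun r hr => (hρ r hr).trans (by omega))
      (henv.trans (map_reg_congr hρ f1).symm) (by rw [r1, hs])
    refine ⟨_, _, .seq e1 (.seq e2 (.sub _ d d (d + 1))), ?_, ?_, ?_, ?_⟩
    · have h1 := Nat.mul_le_mul_left a.cst (hp (Nat.le_add_right a.deg b.deg))
      have h2 := Nat.mul_le_mul_left b.cst (hp (Nat.le_add_left b.deg a.deg))
      have h3 := hone (a.deg + b.deg)
      simp only [Term.cst, Term.deg, add_mul]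
      omega
    · simp [State.setReg, v2, f2 d (by omega), v1]
    · intro r hr
      simp [State.setReg, hr.ne, f2 r (by omega), f1 r hr]
    · simp [State.setReg, r2, r1]
  | @read env a x _ iha =>
    intro ρ d s hρ henv hs
    obtain ⟨ta, s1, e1, l1, v1, f1, r1⟩ := iha ρ d s hρ henv hs
    refine ⟨_, _, .seq e1 (.load _ d 0 d), ?_, ?_, ?_, ?_⟩
    · have h3 := hone a.deg
      simp only [Term.cst, Term.deg, add_mul]
      omega
    · simp [State.setReg, v1, r1, hs]
    · intro r hr
      simp [State.setReg, hr.ne, f1 r hr]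
    · simp [State.setReg, r1]
  | wk _ ih =>
    intro ρ d s hρ henv hs
    exact ih ρ.tail d s (fun r hr => hρ r (List.mem_of_mem_tail hr)) (by simp [henv]) hs
  | @loop env b init step n f _ hn _ _ ihb ihi ihs =>
    intro ρ d s hρ henv hs
    obtain ⟨ti, s1, e1, l1, v1, f1, r1⟩ := ihi ρ d s hρ henv hs
    obtain ⟨tb, s2, e2, l2, v2, f2, r2⟩ := ihb ρ (d + 1) s1 (fun r hr => (hρ r hr).trans (by omega))
      (henv.trans (map_reg_congr hρ f1).symm) (by rw [r1, hs])
    -- Register `d` holds the current value, `d + 1` the remaining rounds, `d + 2` the index;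
    -- temporaries start at `d + 3`. The `5` in `T` counts the instructions after the step: two copy
    -- its value to `d`, three update the counters.
    have hloop := exec_loop (x := d + 1) (d := d)
      (p := .seq (step.compile ((d + 2) :: d :: ρ) (d + 3))
        (.seq (.const d 0) (.seq (.add d d (d + 3)) (.seq (.const (d + 3) 1)
          (.seq (.sub (d + 1) (d + 1) (d + 3)) (.add (d + 2) (d + 2) (d + 3)))))))
      (f := f) (T := step.cst * B ^ step.deg + 5) (n := n) (s₀ := s) rfl (by
        intro s3 i hi h1 h2 h3 h4 h5
        obtain ⟨ts, s4, e4, l4, v4, f4, r4⟩ := ihs i hi ((d + 2) :: d :: ρ) (d + 3) s3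
          (by
            intro r hr
            simp only [List.mem_cons] at hr
            rcases hr with rfl | rfl | hr
            · omega
            · omega
            · exact (hρ r hr).trans (by omega))
          (by simp [h1, h2, henv, map_reg_congr hρ h4]) (by rw [h5, hs])
        refine ⟨_, _, .seq e4 (.seq (.const _ d 0) (.seq (.add _ d d (d + 3))
          (.seq (.const _ (d + 3) 1) (.seq (.sub _ (d + 1) (d + 1) (d + 3))
            (.add _ (d + 2) (d + 2) (d + 3)))))), ?_, ?_, ?_, ?_, ?_, ?_⟩
        · omega
        · simp [State.setReg, v4]
        · simp [State.setReg, f4 (d + 2) (by omega), h2]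
        · simp [State.setReg, f4 (d + 1) (by omega), h3]
          omega
        · intro r hr
          have a1 : r ≠ d := by omega
          have a2 : r ≠ d + 1 := by omega
          have a3 : r ≠ d + 2 := by omega
          have a4 : r ≠ d + 3 := by omega
          simp [State.setReg, a1, a2, a3, a4, f4 r (by omega), h4 r hr]
        · simp [State.setReg, r4, h5])
      n (s2.setReg (d + 2) 0) 0 (by omega) (by simp [State.setReg, f2 d (by omega), v1])
      (by simp [State.setReg]) (by simp [State.setReg, v2])
      (fun r hr => by
        have a3 : r ≠ d + 2 := by omega
        simp [State.setReg, a3, f2 r (by omega), f1 r hr])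
      (by simp [State.setReg, r2, r1])
    obtain ⟨tl, s5, e5, l5, v5, f5, r5⟩ := hloop
    refine ⟨_, s5, .seq e1 (.seq e2 (.seq (.const _ (d + 2) 0) e5)), ?_, v5, f5, r5⟩
    have h1 := Nat.mul_le_mul_left init.cst
      (hp (show init.deg ≤ b.deg + init.deg + step.deg + 1 by omega))
    have h2 := Nat.mul_le_mul_left b.cst
      (hp (show b.deg ≤ b.deg + init.deg + step.deg + 1 by omega))
    -- A round costs the step, the five instructions and one test. With the reset of `d + 2` and the
    -- final test this makes up the `8` in `Term.cst`.
    have h3 : n * (step.cst * B ^ step.deg + 5 + 1) ≤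
        (step.cst + 6) * B ^ (b.deg + init.deg + step.deg + 1) := by
      have : step.cst * B ^ step.deg + 5 + 1 ≤ (step.cst + 6) * B ^ (b.deg + init.deg + step.deg) := by
        have h2 := Nat.mul_le_mul_left step.cst
          (hp (show step.deg ≤ b.deg + init.deg + step.deg by omega))
        have := hone (b.deg + init.deg + step.deg)
        rw [add_mul]
        omega
      calc _ ≤ B * ((step.cst + 6) * B ^ (b.deg + init.deg + step.deg)) := Nat.mul_le_mul hn this
        _ = _ := by ring
    have h4 := hone (b.deg + init.deg + step.deg + 1)
    simp only [Term.cst, Term.deg]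
    rw [add_mul] at h3
    rw [add_mul, add_mul, add_mul]
    omega

/-- Closed terms are computed by programs. -/
theorem Computes.haltsWith {input : List ℕ} {B : ℕ} (hB : 1 ≤ B) {e : Term} {v : ℕ}
    (h : Computes (fun i => input.getD i 0) B [] e v) :
    ∃ t, HaltsWith (e.compile [] 0) input t v ∧ t ≤ e.cst * B ^ e.deg := by
  obtain ⟨t, s, h1, h2, h3, -⟩ := h.result hB [] 0 (initial input) (by simp) (by simp)
    (by funext i; simp [initial])
  exact ⟨t, ⟨s, h1, h3⟩, h2⟩

end Ram

namespace Ram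

/-! ### Derived terms -/

open Classical in
/-- The truth value of a proposition as a number. -/
noncomputable def ind (p : Prop) : ℕ := if p then 1 else 0

theorem ind_of {p : Prop} (h : p) : ind p = 1 := if_pos h

theorem ind_of_not {p : Prop} (h : ¬ p) : ind p = 0 := if_neg h

/-- The least number below `n` with the property `P`, and `n` if there is none. -/
noncomputable def leastBelow (P : ℕ → Prop) : ℕ → ℕ
  | 0 => 0
  | n + 1 => leastBelow P n + ind (leastBelow P n = n ∧ ¬ P n)

/-- The value `n` at stage `n` means that nothing has been found yet. It moves on only if `P n`
fails too, and a value below the stage is frozen. -/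
theorem leastBelow_spec (P : ℕ → Prop) (n : ℕ) :
    leastBelow P n ≤ n ∧ (leastBelow P n < n → P (leastBelow P n)) ∧
      ∀ a < n, P a → leastBelow P n ≤ a := by
  induction n with
  | zero => simp [leastBelow]
  | succ n ih =>
    obtain ⟨h1, h2, h3⟩ := ih
    rcases h1.lt_or_eq with h | h
    · have he : leastBelow P (n + 1) = leastBelow P n := by simp [leastBelow, ind, h.ne]
      rw [he]
      refine ⟨by omega, fun _ => h2 h, fun a ha hPa => ?_⟩
      rcases (Nat.lt_succ_iff.1 ha).lt_or_eq with ha | rfl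
      · exact h3 a ha hPa
      · exact h1
    · by_cases hP : P n
      · have he : leastBelow P (n + 1) = n := by simp [leastBelow, ind, h, hP]
        rw [he]
        refine ⟨by omega, fun _ => hP, fun a ha hPa => ?_⟩
        rcases (Nat.lt_succ_iff.1 ha).lt_or_eq with ha | rfl
        · exact h ▸ h3 a ha hPa
        · exact le_rfl
      · have he : leastBelow P (n + 1) = n + 1 := by simp [leastBelow, ind, h, hP]
        rw [he]
        refine ⟨le_rfl, fun h => (lt_irrefl _ h).elim, fun a ha hPa => ?_⟩
        rcases (Nat.lt_succ_iff.1 ha).lt_or_eq with ha | rfl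
        · have := h3 a ha hPa
          omega
        · exact (hP hPa).elim

/-- This is division by counting: `(q + 1) * b ≤ a` says exactly that `q < a / b`. -/
theorem sum_ind_mul_le (a b : ℕ) (hb : 0 < b) (n : ℕ) :
    ∑ q ∈ Finset.range n, ind ((q + 1) * b ≤ a) = min n (a / b) := by
  induction n with
  | zero => simp
  | succ n ih =>
    rw [Finset.sum_range_succ, ih, ind, ← Nat.le_div_iff_mul_le hb]
    split_ifs <;> omega

namespace Term

/-- A term placed below a binder (a loop binds two variables). -/
def lift (a : Term) : Term := .wk (.wk a)

/-- Truth values are `0` and `1`, and truncated subtraction from `1` tests for zero. -/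
def tLt (a b : Term) : Term := .sub (.const 1) (.sub (.add a (.const 1)) b)

def tEq (a b : Term) : Term := .sub (.const 1) (.add (.sub a b) (.sub b a))

def tNot (p : Term) : Term := .sub (.const 1) p

def tAnd (p q : Term) : Term := tNot (.add (tNot p) (tNot q))

def tImp (p q : Term) : Term := tNot (.sub p q)

def tSum (b body : Term) : Term := .loop b (.const 0) (.add (.var 1) body)

def tForall (b body : Term) : Term := tNot (tSum b (tNot body))

def tExists (b body : Term) : Term := tNot (tNot (tSum b body))

def tLeast (b body : Term) : Term :=
  .loop b (.const 0) (.add (.var 1) (tAnd (tEq (.var 1) (.var 0)) (tNot body)))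

/-- Only the first factor counts iterations; the second factor and the product may exceed the
iteration bound. -/
def tMul (a b : Term) : Term := tSum a (lift b)

def tPow (b e : Term) : Term := .loop e (.const 1) (tMul (lift b) (.var 1))

def tDiv (a b : Term) : Term :=
  tSum a (tNot (tLt (lift a) (tMul (.add (.var 0) (.const 1)) (lift b))))

/-- The digit of `c` with index `j` in base `b`. -/
def tDigit (c b j : Term) : Term :=
  let q := tDiv c (tPow b j)
  .sub q (tMul (tDiv q b) b)

end Term

/-! ### Evaluation of the derived terms -/

namespace Computes

open Term

variable {inp : ℕ → ℕ} {B : ℕ} {env : List ℕ} {a b c e p q body : Term} {x y : ℕ} {P Q : Prop}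

theorem of_eq (h : Computes inp B env e x) (hxy : x = y) : Computes inp B env e y := hxy ▸ h

theorem lift (h : Computes inp B env e x) {i j : ℕ} : Computes inp B (i :: j :: env) e.lift x :=
  .wk (.wk h)

theorem var0 {i : ℕ} : Computes inp B (i :: env) (.var 0) i := .var 0

theorem var1 {i j : ℕ} : Computes inp B (i :: j :: env) (.var 1) j := .var 1

theorem var2 {i j l : ℕ} : Computes inp B (i :: j :: l :: env) (.var 2) l := .var 2

theorem tLt (ha : Computes inp B env a x) (hb : Computes inp B env b y) :
    Computes inp B env (tLt a b) (ind (x < y)) :=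
  (sub (const 1) (sub (add ha (const 1)) hb)).of_eq (by unfold ind; split_ifs <;> omega)

theorem tEq (ha : Computes inp B env a x) (hb : Computes inp B env b y) :
    Computes inp B env (tEq a b) (ind (x = y)) :=
  (sub (const 1) (add (sub ha hb) (sub hb ha))).of_eq (by unfold ind; split_ifs <;> omega)

theorem tNot (hp : Computes inp B env p (ind P)) : Computes inp B env (tNot p) (ind ¬ P) :=
  (sub (const 1) hp).of_eq (by unfold ind; split_ifs <;> simp_all)

theorem tAnd (hp : Computes inp B env p (ind P)) (hq : Computes inp B env q (ind Q)) :
    Computes inp B env (tAnd p q) (ind (P ∧ Q)) :=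
  (sub (const 1) (add hp.tNot hq.tNot)).of_eq (by unfold ind; split_ifs <;> simp_all)

theorem tImp (hp : Computes inp B env p (ind P)) (hq : Computes inp B env q (ind Q)) :
    Computes inp B env (tImp p q) (ind (P → Q)) :=
  (sub (const 1) (sub hp hq)).of_eq (by unfold ind; split_ifs <;> simp_all)

theorem tIff (hp : Computes inp B env p (ind P)) (hq : Computes inp B env q (ind Q)) :
    Computes inp B env (Term.tEq p q) (ind (P ↔ Q)) :=
  (tEq hp hq).of_eq (by unfold ind; split_ifs <;> simp_all)

theorem tSum {n : ℕ} {f : Fin n → ℕ} (hb : Computes inp B env b n) (hn : n ≤ B)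
    (h : ∀ (i : Fin n) (j : ℕ), Computes inp B (i :: j :: env) body (f i)) :
    Computes inp B env (tSum b body) (∑ i, f i) := by
  rw [Finset.sum_fin_eq_sum_range]
  refine loop (fun i => ∑ j ∈ Finset.range i, if h : j < n then f ⟨j, h⟩ else 0) hb hn
    (const 0) fun i hi => ?_
  simp only [Finset.sum_range_succ, dif_pos hi]
  exact add var1 (h ⟨i, hi⟩ _)

theorem tForall {n : ℕ} {R : Fin n → Prop} (hb : Computes inp B env b n) (hn : n ≤ B)
    (h : ∀ (i : Fin n) (j : ℕ), Computes inp B (i :: j :: env) body (ind (R i))) :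
    Computes inp B env (tForall b body) (ind (∀ i, R i)) := by
  refine (sub (const 1) (tSum hb hn fun i j => (h i j).tNot)).of_eq ?_
  by_cases hR : ∀ i, R i
  · simp [ind, hR]
  · obtain ⟨i, hi⟩ := not_forall.1 hR
    have : ind (¬ R i) ≤ ∑ i, ind (¬ R i) :=
      Finset.single_le_sum (f := fun i => ind (¬ R i)) (fun _ _ => Nat.zero_le _)
        (Finset.mem_univ i)
    have h1 := ind_of hi
    rw [ind_of_not hR]
    omega

theorem tExists {n : ℕ} {R : Fin n → Prop} (hb : Computes inp B env b n) (hn : n ≤ B)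
    (h : ∀ (i : Fin n) (j : ℕ), Computes inp B (i :: j :: env) body (ind (R i))) :
    Computes inp B env (tExists b body) (ind (∃ i, R i)) := by
  refine (sub (const 1) (sub (const 1) (tSum hb hn h))).of_eq ?_
  by_cases hR : ∃ i, R i
  · obtain ⟨i, hi⟩ := hR
    have : ind (R i) ≤ ∑ i, ind (R i) :=
      Finset.single_le_sum (f := fun i => ind (R i)) (fun _ _ => Nat.zero_le _)
        (Finset.mem_univ i)
    have h1 := ind_of hi
    rw [ind_of (p := ∃ i, R i) ⟨i, hi⟩]
    omega
  · simp only [not_exists] at hR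
    simp [ind, hR]

theorem tLeast {n : ℕ} {R : ℕ → Prop} (hb : Computes inp B env b n) (hn : n ≤ B)
    (h : ∀ i < n, ∀ j : ℕ, Computes inp B (i :: j :: env) body (ind (R i))) :
    Computes inp B env (tLeast b body) (leastBelow R n) :=
  loop (leastBelow R) hb hn (const 0) fun i hi =>
    add var1 (.tAnd (.tEq var1 var0) (h i hi _).tNot)

theorem tMul (ha : Computes inp B env a x) (hb : Computes inp B env b y) (hx : x ≤ B) :
    Computes inp B env (tMul a b) (x * y) :=
  (tSum (f := fun _ => y) ha hx fun _ _ => hb.lift).of_eq (by simp)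

theorem tPow (hb : Computes inp B env b x) (he : Computes inp B env e y) (hx : x ≤ B)
    (hy : y ≤ B) : Computes inp B env (tPow b e) (x ^ y) :=
  loop (fun i => x ^ i) he hy (const 1) fun i _ => by
    -- The base has to be the first factor, because it is the one known to be at most `B`.
    rw [pow_succ']
    exact .tMul hb.lift var1 hx

theorem tDiv (ha : Computes inp B env a x) (hb : Computes inp B env b y) (hx : x ≤ B)
    (hy : 0 < y) : Computes inp B env (tDiv a b) (x / y) := by
  refine (tSum (f := fun q : Fin x => ind ¬ x < ((q : ℕ) + 1) * y) ha hx fun q _ => ?_).of_eq ?_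
  · exact .tNot (.tLt ha.lift (.tMul (.add var0 (.const 1)) hb.lift (q.2.trans_le hx)))
  · simp only [not_lt]
    rw [Fin.sum_univ_eq_sum_range (fun q => ind ((q + 1) * y ≤ x)), sum_ind_mul_le _ _ hy]
    exact min_eq_right (Nat.div_le_self x y)

theorem tDigit {z : ℕ} (hc : Computes inp B env c z) (hb : Computes inp B env b x)
    (he : Computes inp B env e y) (hz : z ≤ B) (hx : x ≤ B) (hy : y ≤ B) (hx0 : 0 < x) :
    Computes inp B env (tDigit c b e) (z / x ^ y % x) := by
  have hq := tDiv hc (tPow hb he hx hy) hz (pow_pos hx0 y)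
  have hqB : z / x ^ y ≤ B := (Nat.div_le_self _ _).trans hz
  refine (sub hq (tMul (tDiv hq hb hqB hx0) hb ((Nat.div_le_self _ _).trans hqB))).of_eq ?_
  rw [Nat.mod_eq_sub, mul_comm]

end Computes

end Ram

namespace ListRecoloring

/-! ### Reconfiguration sequences -/

section

variable {V C : Type} {G : SimpleGraph V} {L : V → Finset C}

/-- There is a reconfiguration sequence of length `ℓ` from `f` to `g`. -/
def Reconfigurable (G : SimpleGraph V) (L : V → Finset C) (ℓ : ℕ) (f g : V → C) : Prop :=
  ∃ s, IsReconfSeq G L f g ℓ s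

theorem Reconfigurable.refl {f : V → C} (hf : IsListColoring G L f) :
    Reconfigurable G L 0 f f :=
  ⟨fun _ => f, rfl, rfl, fun _ _ => hf, fun _ h => (Nat.not_lt_zero _ h).elim⟩

theorem Reconfigurable.cons {f h g : V → C} {ℓ : ℕ} (hf : IsListColoring G L f)
    (hfh : AdjacentColorings f h) (hg : Reconfigurable G L ℓ h g) :
    Reconfigurable G L (ℓ + 1) f g := by
  obtain ⟨s, h0, h1, h2, h3⟩ := hg
  refine ⟨fun i => i.casesOn f s, rfl, h1, fun i hi => ?_, fun i hi => ?_⟩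
  · cases i with
    | zero => exact hf
    | succ i => exact h2 i (by omega)
  · cases i with
    | zero => simpa [h0] using hfh
    | succ i => exact h3 i (by omega)

theorem Reconfigurable.trans {g h : V → C} {ℓ' : ℕ} (hgh : Reconfigurable G L ℓ' g h) {ℓ : ℕ} :
    ∀ {f : V → C}, Reconfigurable G L ℓ f g → Reconfigurable G L (ℓ + ℓ') f h := by
  induction ℓ with
  | zero =>
    rintro f ⟨s, rfl, rfl, -, -⟩
    simpa using hgh
  | succ ℓ ih =>
    rintro f ⟨s, rfl, h1, h2, h3⟩
    rw [Nat.add_right_comm]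
    exact .cons (h2 0 (by omega)) (h3 0 (by omega))
      (ih ⟨fun i => s (i + 1), rfl, h1, fun i hi => h2 _ (by omega), fun i hi => h3 _ (by omega)⟩)

/-- The number of vertices at which two colorings differ. -/
noncomputable def cost [Fintype V] (f g : V → C) : ℕ := ∑ v, Ram.ind (f v ≠ g v)

theorem cost_eq_ncard [Fintype V] (f g : V → C) : cost f g = {v | f v ≠ g v}.ncard := by
  classical
  rw [Set.ncard_eq_toFinset_card', Set.toFinset_ofPred, Finset.card_filter]
  exact Finset.sum_congr rfl fun v _ => by unfold Ram.ind; congr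

theorem cost_self [Fintype V] (f : V → C) : cost f f = 0 := by simp [cost, Ram.ind]

theorem cost_le_card [Fintype V] (f g : V → C) : cost f g ≤ Fintype.card V := by
  classical
  calc cost f g ≤ ∑ _v : V, 1 := Finset.sum_le_sum fun v _ => by unfold Ram.ind; split_ifs <;> simp
    _ = _ := by simp

/-- If the vertices at which two colorings differ are independent, then they can be recolored one
after another. -/
theorem reconfigurable_cost [Fintype V] {g : V → C} (hg : IsListColoring G L g) (m : ℕ) :
    ∀ {f : V → C}, cost f g = m → IsListColoring G L f →
      (∀ u v, f u ≠ g u → f v ≠ g v → ¬ G.Adj u v) → Reconfigurable G L m f g := by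
  classical
  induction m with
  | zero =>
    intro f hm hf _
    have : f = g := by
      rw [cost_eq_ncard, Set.ncard_eq_zero (Set.toFinite _)] at hm
      funext v
      by_contra hv
      have : v ∈ {v | f v ≠ g v} := hv
      simp [hm] at this
    subst this
    exact .refl hf
  | succ m ih =>
    intro f hm hf hind
    rw [cost_eq_ncard] at hm
    obtain ⟨x, hx⟩ := Set.nonempty_of_ncard_ne_zero (s := {v | f v ≠ g v}) (by omega)
    have hx' : f x ≠ g x := hx
    have hset : {v | Function.update f x (g x) v ≠ g v} = {v | f v ≠ g v} \ {x} := by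
      ext v
      by_cases hv : v = x
      · subst hv; simp
      · simp [hv]
    have hne : ∀ v, Function.update f x (g x) v ≠ g v → f v ≠ g v := fun v hv => by
      have : v ∈ {v | f v ≠ g v} \ {x} := hset ▸ hv
      exact this.1
    refine .cons hf (h := Function.update f x (g x)) ?_ (ih ?_ ⟨?_, ?_⟩ ?_)
    · rw [AdjacentColorings, Set.ncard_eq_one]
      refine ⟨x, ?_⟩
      ext v
      by_cases hv : v = x
      · subst hv; simpa using hx'
      · simp [hv]
    · rw [cost_eq_ncard, hset, Set.ncard_sdiff_singleton_of_mem hx, hm]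
      rfl
    · intro v
      by_cases hv : v = x
      · subst hv; simpa using hg.1 v
      · simpa [hv] using hf.1 v
    -- By independence, every neighbor of `x` already has its final color.
    · have key : ∀ v, G.Adj x v → g x ≠ f v := fun v hv h => by
        have hfv : f v = g v := by
          by_contra hne
          exact hind x v hx' hne hv
        exact hg.2 x v hv (h.trans hfv)
      intro u v huv
      by_cases hu : u = x
      · subst hu
        have hv : v ≠ u := huv.ne'
        simpa [hv] using key v huv
      · by_cases hv : v = x
        · subst hv
          simpa [hu] using (key u huv.symm).symm
        · simpa [hu, hv] using hf.2 u v huv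
    · exact fun u v hu hv => hind u v (hne u hu) (hne v hv)

end

/-! ### Short walks -/

/-- Beyond its end a walk stays at its last vertex, where `hw` makes each further term zero. -/
theorem sum_getVert_eq_sum_darts {S : Type} {H : SimpleGraph S} {w : S → S → ℕ}
    (hw : ∀ a, w a a = 0) {a b : S} (p : H.Walk a b) :
    ∀ N, p.length ≤ N → ∑ i ∈ Finset.range N, w (p.getVert i) (p.getVert (i + 1)) =
      (p.darts.map fun d => w d.fst d.snd).sum := by
  induction p with
  | nil => intro N _; simp [hw]
  | cons h p ih =>
    intro N hN
    obtain ⟨N, rfl⟩ : ∃ N', N = N' + 1 := ⟨N - 1, by simp at hN; omega⟩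
    rw [Finset.sum_range_succ']
    simp only [SimpleGraph.Walk.getVert_cons_succ, SimpleGraph.Walk.getVert_zero,
      SimpleGraph.Walk.darts_cons, List.map_cons, List.sum_cons]
    rw [ih N (by simpa using hN), add_comm]

theorem exists_walk_sum_le {S : Type} {R : S → S → Prop} (w : S → S → ℕ) (ℓ : ℕ) :
    ∀ (t : ℕ → S), (∀ i < ℓ, R (t i) (t (i + 1))) →
      ∃ p : (SimpleGraph.fromRel R).Walk (t 0) (t ℓ),
        (p.darts.map fun d => w d.fst d.snd).sum ≤
          ∑ i ∈ Finset.range ℓ, w (t i) (t (i + 1)) := by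
  induction ℓ with
  | zero => intro t _; exact ⟨.nil, by simp⟩
  | succ ℓ ih =>
    intro t ht
    obtain ⟨p, hp⟩ := ih (fun i => t (i + 1)) fun i hi => ht (i + 1) (by omega)
    rw [Finset.sum_range_succ']
    -- A simple graph has no loops, so a stationary step is dropped, which can only lower the
    -- weight.
    by_cases h : t 0 = t 1
    · refine ⟨p.copy h.symm rfl, ?_⟩
      rw [SimpleGraph.Walk.darts_copy]
      omega
    · refine ⟨.cons ((SimpleGraph.fromRel_adj _ _ _).2 ⟨h, .inl (ht 0 (by omega))⟩) p, ?_⟩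
      simp only [SimpleGraph.Walk.darts_cons, List.map_cons, List.sum_cons]
      rw [add_comm]
      exact Nat.add_le_add_right hp _

/-- A walk can be replaced by one with at most as many steps as there are states, without
increasing its weight. -/
theorem exists_short_walk {S : Type} [Fintype S] {R : S → S → Prop} (hR : ∀ a b, R a b → R b a)
    {w : S → S → ℕ} (hw : ∀ a, w a a = 0) {ℓ : ℕ} {t : ℕ → S}
    (ht : ∀ i < ℓ, R (t i) (t (i + 1))) :
    ∃ t' : ℕ → S, t' 0 = t 0 ∧ t' (Fintype.card S) = t ℓ ∧
      (∀ i, t' i = t' (i + 1) ∨ R (t' i) (t' (i + 1))) ∧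
      ∑ i ∈ Finset.range (Fintype.card S), w (t' i) (t' (i + 1)) ≤
        ∑ i ∈ Finset.range ℓ, w (t i) (t (i + 1)) := by
  classical
  obtain ⟨p, hp⟩ := exists_walk_sum_le w ℓ t ht
  have hlen : p.bypass.length ≤ Fintype.card S := p.bypass_isPath.length_lt.le
  refine ⟨p.bypass.getVert, by simp, p.bypass.getVert_of_length_le hlen, fun i => ?_, ?_⟩
  · rcases lt_or_ge i p.bypass.length with hi | hi
    · have := p.bypass.adj_getVert_succ hi
      rw [SimpleGraph.fromRel_adj] at this
      exact .inr (this.2.elim id fun h => hR _ _ h)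
    · left
      rw [p.bypass.getVert_of_length_le hi, p.bypass.getVert_of_length_le (by omega)]
  · rw [sum_getVert_eq_sum_darts hw _ _ hlen]
    -- The path uses a sublist of the darts of the walk, and weights are nonnegative.
    refine le_trans (List.Sublist.sum_le_sum ?_ ?_) hp
    · exact p.darts_bypass_sublist_darts.map _
    · simp

end ListRecoloring

namespace ListRecoloring

namespace Instance

variable (I : Instance)

/-! ### Twin classes -/

/-- Vertices with the same initial and target color, the same list and the same neighbors. -/
def Twin (u v : Fin I.n) : Prop :=
  I.ini u = I.ini v ∧ I.tar u = I.tar v ∧ (∀ c, c ∈ I.list u ↔ c ∈ I.list v) ∧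
    ∀ w, I.graph.Adj u w ↔ I.graph.Adj v w

/-- `v` is the first vertex of its twin class. -/
def IsRep (v : Fin I.n) : Prop := ∀ u : Fin I.n, (u : ℕ) < v → ¬ I.Twin u v

/-- The number of twin classes. -/
noncomputable def numClasses : ℕ := ∑ v, Ram.ind (I.IsRep v)

/-- The number of twin classes that start before the class of `v`. -/
noncomputable def classIdx (v : Fin I.n) : ℕ :=
  ∑ u, Ram.ind (I.IsRep u ∧ ∀ w : Fin I.n, ¬ (u : ℕ) < w → ¬ I.Twin w v)

variable {I}

theorem Twin.refl (v : Fin I.n) : I.Twin v v := ⟨rfl, rfl, fun _ => Iff.rfl, fun _ => Iff.rfl⟩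

theorem Twin.symm {u v : Fin I.n} (h : I.Twin u v) : I.Twin v u :=
  ⟨h.1.symm, h.2.1.symm, fun c => (h.2.2.1 c).symm, fun w => (h.2.2.2 w).symm⟩

theorem Twin.trans {u v w : Fin I.n} (h : I.Twin u v) (h' : I.Twin v w) : I.Twin u w :=
  ⟨h.1.trans h'.1, h.2.1.trans h'.2.1, fun c => (h.2.2.1 c).trans (h'.2.2.1 c),
    fun x => (h.2.2.2 x).trans (h'.2.2.2 x)⟩

/-- If `u` and `v` were adjacent twins, then `v`, a neighbor of `u`, would be a neighbor of itself.
-/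
theorem Twin.not_adj {u v : Fin I.n} (h : I.Twin u v) : ¬ I.graph.Adj u v := fun hadj =>
  I.graph.loopless.irrefl v ((h.2.2.2 v).1 hadj)

theorem exists_isRep (v : Fin I.n) : ∃ r, I.IsRep r ∧ I.Twin r v ∧
    ∀ w, I.Twin w v → (r : ℕ) ≤ w := by
  obtain ⟨r, hr, hmin⟩ := WellFounded.has_min (wellFounded_lt (α := Fin I.n)) {u | I.Twin u v}
    ⟨v, .refl v⟩
  exact ⟨r, fun u hu hur => hmin u (hur.trans hr) hu, hr,
    fun w hw => le_of_not_gt fun h => hmin w hw h⟩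

theorem classIdx_lt (v : Fin I.n) : I.classIdx v < I.numClasses := by
  obtain ⟨r, hr, hrv, -⟩ := exists_isRep v
  -- The representative of the class of `v` is counted among the classes but not before `v`.
  refine Finset.sum_lt_sum (fun u _ => ?_) ⟨r, Finset.mem_univ r, ?_⟩
  · unfold Ram.ind
    split_ifs <;> simp_all
  · have : ¬ ∀ w : Fin I.n, ¬ (r : ℕ) < w → ¬ I.Twin w v := fun h => h r (lt_irrefl _) hrv
    rw [Ram.ind_of hr, Ram.ind_of_not fun h => this h.2]
    exact Nat.one_pos

theorem classIdx_eq_iff {u v : Fin I.n} : I.classIdx u = I.classIdx v ↔ I.Twin u v := by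
  -- If the class of `u` starts first, everything counted for `u` is counted for `v`, and its
  -- representative `r` only for `v`.
  have hlt : ∀ {u v r r' : Fin I.n}, I.IsRep r → I.Twin r u → I.Twin r' v →
      (∀ w, I.Twin w u → (r : ℕ) ≤ w) → (∀ w, I.Twin w v → (r' : ℕ) ≤ w) → (r : ℕ) < r' →
      I.classIdx u < I.classIdx v := by
    intro u v r r' hr hru hrv hmu hmv hlt
    refine Finset.sum_lt_sum (fun x _ => ?_) ⟨r, Finset.mem_univ r, ?_⟩
    · by_cases hx : I.IsRep x ∧ ∀ w : Fin I.n, ¬ (x : ℕ) < w → ¬ I.Twin w u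
      · have h1 : (x : ℕ) < r := by
          by_contra h
          exact hx.2 r h hru
        have h2 : I.IsRep x ∧ ∀ w : Fin I.n, ¬ (x : ℕ) < w → ¬ I.Twin w v :=
          ⟨hx.1, fun w hw hwv => by have := hmv w hwv; omega⟩
        rw [Ram.ind_of hx, Ram.ind_of h2]
      · rw [Ram.ind_of_not hx]
        exact Nat.zero_le _
    · have h1 : ¬ ∀ w : Fin I.n, ¬ (r : ℕ) < w → ¬ I.Twin w u := fun h => h r (lt_irrefl _) hru
      have h2 : ∀ w : Fin I.n, ¬ (r : ℕ) < w → ¬ I.Twin w v := fun w hw hwv => by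
        have := hmv w hwv
        omega
      rw [Ram.ind_of_not fun h => h1 h.2, Ram.ind_of ⟨hr, h2⟩]
      exact Nat.one_pos
  constructor
  · intro h
    obtain ⟨r, hr, hru, hmu⟩ := exists_isRep u
    obtain ⟨r', hr', hrv, hmv⟩ := exists_isRep v
    rcases lt_trichotomy (r : ℕ) r' with h' | h' | h'
    · exact absurd h (hlt hr hru hrv hmu hmv h').ne
    · obtain rfl := Fin.ext h'
      exact hru.symm.trans hrv
    · exact absurd h (hlt hr' hrv hru hmv hmu h').ne'
  · intro h
    have : ∀ w, I.Twin w u ↔ I.Twin w v := fun w => ⟨fun h' => h'.trans h, fun h' => h'.trans h.symm⟩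
    simp only [classIdx, this]

/-- The number of twin classes is bounded in terms of the number of colors and the size of a vertex
cover. -/
theorem numClasses_le {c : ℕ} (hc : I.graph.vertexCoverNum ≤ c) :
    I.numClasses ≤ c + 2 ^ c * (2 ^ I.k * (I.k * I.k)) := by
  classical
  obtain ⟨S, hS, hcov⟩ := I.graph.vertexCoverNum_exists
  have hScard : S.toFinset.card ≤ c := by
    rw [← hS, Set.encard_eq_coe_toFinset_card] at hc
    exact_mod_cast hc
  have hnum : I.numClasses = (Finset.univ.filter I.IsRep).card := by
    rw [Finset.card_filter]
    exact Finset.sum_congr rfl fun v _ => by unfold Ram.ind; congr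
  let T : Finset (Fin I.n ⊕ (Finset (Fin I.n) × (Finset (Fin I.k) × (Fin I.k × Fin I.k)))) :=
    S.toFinset.disjSum (S.toFinset.powerset ×ˢ Finset.univ)
  -- A cover vertex is mapped to itself; any other representative is determined by its neighborhood
  -- in the cover, its list and its two colors.
  let φ (v : Fin I.n) : Fin I.n ⊕ (Finset (Fin I.n) × (Finset (Fin I.k) × (Fin I.k × Fin I.k))) :=
    if v ∈ S then .inl v else .inr (Finset.univ.filter (I.graph.Adj v), I.list v, I.ini v, I.tar v)
  have hT : T.card ≤ c + 2 ^ c * (2 ^ I.k * (I.k * I.k)) := by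
    simp only [T, Finset.card_disjSum, Finset.card_product, Finset.card_powerset, Finset.card_univ,
      Fintype.card_prod, Fintype.card_finset, Fintype.card_fin]
    gcongr
    simp
  rw [hnum]
  refine le_trans (Finset.card_le_card_of_injOn φ ?_ ?_) hT
  · intro v _
    by_cases hv : v ∈ S
    · simp [φ, T, hv]
    · simp only [φ, T, if_neg hv, Finset.mem_coe, Finset.inr_mem_disjSum,
        Finset.mem_product, Finset.mem_powerset, Finset.mem_univ, and_true]
      intro w hw
      have hw : I.graph.Adj v w := by simpa using hw
      exact Set.mem_toFinset.2 ((hcov hw).resolve_left hv)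
  · intro u hu v hv huv
    have hu : I.IsRep u := by simpa using hu
    have hv : I.IsRep v := by simpa using hv
    by_cases huS : u ∈ S <;> by_cases hvS : v ∈ S
    · simpa [φ, huS, hvS] using huv
    · simp [φ, huS, hvS] at huv
    · simp [φ, huS, hvS] at huv
    · simp only [φ, if_neg huS, if_neg hvS, Sum.inr.injEq, Prod.mk.injEq] at huv
      obtain ⟨h1, h2, h3, h4⟩ := huv
      have htw : I.Twin u v := ⟨h3, h4, fun c => by rw [h2], fun w => by
        simpa using Finset.ext_iff.1 h1 w⟩
      rcases lt_trichotomy (u : ℕ) v with h | h | h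
      · exact (hv u h htw).elim
      · exact Fin.ext h
      · exact (hu v h htw.symm).elim

/-! ### Colorings that are constant on twin classes -/

/-- The number of codes of colorings that are constant on twin classes. -/
noncomputable def numCodes (I : Instance) : ℕ := I.k ^ I.numClasses

/-- The coloring with a given code: the colors of the twin classes are the digits of the code. -/
noncomputable def color (c : Fin I.numCodes) (v : Fin I.n) : Fin I.k :=
  finFunctionFinEquiv.symm c ⟨I.classIdx v, classIdx_lt v⟩

theorem exists_color_eq {f : Fin I.n → Fin I.k} (hf : ∀ u v, I.Twin u v → f u = f v) :
    ∃ c, color c = f := by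
  -- `Function.extend` needs a default off the range of `classIdx`. Without vertices there may be no
  -- color, but then there is no class either.
  have : Nonempty (Fin I.numClasses → Fin I.k) := by
    rcases isEmpty_or_nonempty (Fin I.n) with h | ⟨⟨v⟩⟩
    · refine ⟨fun j => ?_⟩
      have : I.numClasses = 0 := by simp [numClasses]
      exact (Fin.cast this j).elim0
    · exact ⟨fun _ => f v⟩
  obtain ⟨g⟩ := this
  refine ⟨finFunctionFinEquiv (Function.extend (fun v => ⟨I.classIdx v, classIdx_lt v⟩) f g), ?_⟩
  funext v
  refine (congrFun (Equiv.symm_apply_apply _ _) _).trans ?_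
  exact Function.FactorsThrough.extend_apply (g := f)
    (f := fun v => (⟨I.classIdx v, classIdx_lt v⟩ : Fin I.numClasses))
    (fun u v huv => hf u v (classIdx_eq_iff.1 (Fin.mk.inj_iff.1 huv))) g v

/-- Two codes whose colorings differ only within one twin class. -/
def Step (c c' : Fin I.numCodes) : Prop :=
  ∀ u v, ¬ color c u = color c' u ∧ ¬ color c v = color c' v → I.Twin u v

/-- Walks from the initial to the target coloring that recolor a whole twin class in each step. -/
def IsWalk (s : Fin (I.numCodes + 1) → Fin I.numCodes) : Prop :=
  (∀ v, color (s 0) v = I.ini v) ∧ (∀ v, color (s (Fin.last _)) v = I.tar v) ∧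
    (∀ j, IsListColoring I.graph I.list (color (s j))) ∧
    ∀ j : Fin I.numCodes, Step (s j.castSucc) (s j.succ)

/-- The number of vertices that are recolored in a walk. -/
noncomputable def walkCost (s : Fin (I.numCodes + 1) → Fin I.numCodes) : ℕ :=
  ∑ j : Fin I.numCodes, cost (color (s j.castSucc)) (color (s j.succ))

/-- The vertices that change in one step are pairwise twins, hence independent, so the step splits
into single recolorings. -/
theorem IsWalk.reconfigurable {s : Fin (I.numCodes + 1) → Fin I.numCodes} (h : IsWalk s) :
    Reconfigurable I.graph I.list (walkCost s) I.ini I.tar := by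
  obtain ⟨h0, h1, h2, h3⟩ := h
  have hini : color (s 0) = I.ini := funext h0
  have htar : color (s (Fin.last _)) = I.tar := funext h1
  rw [← hini, ← htar]
  have key : ∀ m (hm : m < I.numCodes + 1), Reconfigurable I.graph I.list
      (∑ j : Fin m, cost (color (s ⟨j, by omega⟩)) (color (s ⟨j + 1, by omega⟩)))
      (color (s 0)) (color (s ⟨m, hm⟩)) := by
    intro m
    induction m with
    | zero => intro _; simpa using Reconfigurable.refl (h2 0)
    | succ m ih =>
      intro hm
      rw [Fin.sum_univ_castSucc]
      refine Reconfigurable.trans ?_ (ih (by omega))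
      refine reconfigurable_cost (h2 _) _ rfl (h2 _) fun u v hu hv => ?_
      exact (h3 ⟨m, by omega⟩ u v ⟨hu, hv⟩).not_adj
  exact key I.numCodes (Nat.lt_succ_self _)

/-- Each class imitates its least often recolored member `σ v`; the resulting walk is then
shortened. -/
theorem exists_isWalk {ℓ : ℕ} (h : Reconfigurable I.graph I.list ℓ I.ini I.tar) :
    ∃ s : Fin (I.numCodes + 1) → Fin I.numCodes, IsWalk s ∧ walkCost s ≤ ℓ := by
  obtain ⟨s, hs0, hs1, hs2, hs3⟩ := h
  -- the number of times that a vertex is recolored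
  let r (v : Fin I.n) : ℕ := ∑ i ∈ Finset.range ℓ, Ram.ind (s i v ≠ s (i + 1) v)
  have hσ : ∀ v, ∃ u, I.Twin u v ∧ ∀ w, I.Twin w v → r u ≤ r w := by
    intro v
    obtain ⟨u, hu, hmin⟩ := WellFounded.has_min (measure r).wf {u | I.Twin u v} ⟨v, .refl v⟩
    exact ⟨u, hu, fun w hw => not_lt.1 (hmin w hw)⟩
  -- The minimizers are chosen separately for each vertex and may differ among twins. Passing
  -- through a canonical representative makes the choice constant on classes.
  have hrep : ∃ ρ : Fin I.n → Fin I.n, (∀ v, I.Twin (ρ v) v) ∧ ∀ u v, I.Twin u v → ρ u = ρ v := by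
    choose ρ _ h1 h2 using exists_isRep (I := I)
    refine ⟨ρ, h1, fun u v huv => Fin.ext (le_antisymm ?_ ?_)⟩
    · exact h2 u _ ((h1 v).trans huv.symm)
    · exact h2 v _ ((h1 u).trans huv)
  obtain ⟨ρ, hρ, hρc⟩ := hrep
  choose σ' hσ1 hσ2 using hσ
  let σ (v : Fin I.n) : Fin I.n := σ' (ρ v)
  have hσtwin : ∀ v, I.Twin (σ v) v := fun v => (hσ1 _).trans (hρ v)
  have hσmin : ∀ v, r (σ v) ≤ r v := fun v => hσ2 _ _ (hρ v).symm
  have hσc : ∀ u v, I.Twin u v → σ u = σ v := fun u v huv => congrArg σ' (hρc u v huv)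
  choose t ht using fun i => exists_color_eq (f := fun v => s i (σ v))
    fun u v huv => congrArg (s i) (hσc u v huv)
  -- Replacing each end of an edge by a twin gives an edge again, so `σ u` and `σ v` are adjacent
  -- whenever `u` and `v` are.
  have hvalid : ∀ i ≤ ℓ, IsListColoring I.graph I.list (color (t i)) := by
    intro i hi
    rw [ht]
    refine ⟨fun v => ((hσtwin v).2.2.1 _).1 ((hs2 i hi).1 _), fun u v huv => (hs2 i hi).2 _ _ ?_⟩
    exact ((hσtwin u).2.2.2 _).2 (((hσtwin v).2.2.2 _).2 huv.symm).symm
  have hstep : ∀ i < ℓ, Step (t i) (t (i + 1)) := by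
    intro i hi u v huv
    rw [ht, ht] at huv
    -- Only `x` is recolored, so the vertices that change are those with `σ v = x`, all twins of
    -- `x`.
    obtain ⟨x, hx⟩ := Set.ncard_eq_one.1 (hs3 i hi)
    have h1 : σ u ∈ {v | s i v ≠ s (i + 1) v} := huv.1
    have h2 : σ v ∈ {v | s i v ≠ s (i + 1) v} := huv.2
    rw [hx] at h1 h2
    have h1 : σ u = x := h1
    have h2 : σ v = x := h2
    exact (hσtwin u).symm.trans ((h1.trans h2.symm) ▸ hσtwin v)
  -- Double counting: summed over vertices instead of times, the new cost is the sum of `r (σ v) ≤ r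
  -- v`, and the `r v` add up to `ℓ`.
  have hcost : ∑ i ∈ Finset.range ℓ, cost (color (t i)) (color (t (i + 1))) ≤ ℓ := by
    calc ∑ i ∈ Finset.range ℓ, cost (color (t i)) (color (t (i + 1)))
        = ∑ v, r (σ v) := by
          simp only [cost, ht, r]
          exact Finset.sum_comm
      _ ≤ ∑ v, r v := Finset.sum_le_sum fun v _ => hσmin v
      _ = ∑ i ∈ Finset.range ℓ, cost (s i) (s (i + 1)) := Finset.sum_comm
      _ = ∑ i ∈ Finset.range ℓ, 1 := Finset.sum_congr rfl fun i hi => by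
          rw [cost_eq_ncard]
          exact hs3 i (Finset.mem_range.1 hi)
      _ = ℓ := by simp
  -- The relation includes validity of both ends, so the states of the shortened walk are still list
  -- colorings.
  obtain ⟨t', h0, h1, h2, h3⟩ := exists_short_walk
    (R := fun c c' : Fin I.numCodes => (IsListColoring I.graph I.list (color c) ∧
      IsListColoring I.graph I.list (color c')) ∧ Step c c')
    (fun a b h => ⟨h.1.symm, fun u v huv => h.2 u v ⟨fun e => huv.1 e.symm, fun e => huv.2 e.symm⟩⟩)
    (w := fun c c' => cost (color c) (color c')) (fun _ => cost_self _) (ℓ := ℓ) (t := t)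
    fun i hi => ⟨⟨hvalid i hi.le, hvalid (i + 1) hi⟩, hstep i hi⟩
  rw [Fintype.card_fin] at h1 h3
  refine ⟨fun j => t' j, ⟨?_, ?_, ?_, ?_⟩, ?_⟩
  · intro v
    simp only [Fin.val_zero, h0, ht, hs0]
    exact (hσtwin v).1
  · intro v
    simp only [Fin.val_last, h1, ht, hs1]
    exact (hσtwin v).2.1
  · rintro ⟨j, hj⟩
    simp only
    clear hj
    induction j with
    | zero => rw [h0]; exact hvalid 0 (Nat.zero_le _)
    | succ j ih =>
      rcases h2 j with h | h
      · rwa [← h]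
      · exact h.1.2
  · intro j
    simp only [Fin.val_castSucc, Fin.val_succ]
    rcases h2 j with h | h
    · rw [← h]
      exact fun u v huv => (huv.1 rfl).elim
    · exact h.2
  · refine le_trans (le_of_eq ?_) (h3.trans hcost)
    exact Fin.sum_univ_eq_sum_range (fun i => cost (color (t' i)) (color (t' (i + 1)))) _

/-! ### Exhaustive search over walks -/

/-- There is a walk of a given cost. -/
def HasWalkOfCost (I : Instance) (ℓ : ℕ) : Prop :=
  ∃ w : Fin (I.numCodes ^ (I.numCodes + 1)),
    IsWalk (finFunctionFinEquiv.symm w) ∧ walkCost (I := I) (finFunctionFinEquiv.symm w) = ℓ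

theorem HasWalkOfCost.lt {ℓ : ℕ} (h : I.HasWalkOfCost ℓ) : ℓ < I.n * I.numCodes + 1 := by
  obtain ⟨w, -, rfl⟩ := h
  refine Nat.lt_succ_of_le ?_
  calc walkCost _ ≤ ∑ _j : Fin I.numCodes, I.n :=
        Finset.sum_le_sum fun j _ => (cost_le_card _ _).trans (by simp)
    _ = _ := by simp [mul_comm]

/-- Each walk cost is the length of some sequence, and each sequence is at least as long as some
walk cost, so the minima agree. Walk costs lie below the search bound, and the indicator gives `0`
for a no-instance. -/
theorem answer_eq (I : Instance) :
    I.answer = Ram.ind (∃ i : Fin (I.n * I.numCodes + 1), I.HasWalkOfCost i) *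
      (Ram.leastBelow I.HasWalkOfCost (I.n * I.numCodes + 1) + 1) := by
  have hwalk : ∀ {ℓ}, I.HasWalkOfCost ℓ → Reconfigurable I.graph I.list ℓ I.ini I.tar := by
    rintro ℓ ⟨w, h1, rfl⟩
    exact h1.reconfigurable
  have hex : ∀ {ℓ}, Reconfigurable I.graph I.list ℓ I.ini I.tar →
      ∃ m ≤ ℓ, I.HasWalkOfCost m := by
    intro ℓ h
    obtain ⟨s, h1, h2⟩ := exists_isWalk h
    exact ⟨_, h2, finFunctionFinEquiv s, by rwa [Equiv.symm_apply_apply],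
      by rw [Equiv.symm_apply_apply]⟩
  have hopt : I.opt = ⨅ (ℓ : ℕ) (_ : Reconfigurable I.graph I.list ℓ I.ini I.tar), (ℓ : ℕ∞) := rfl
  obtain ⟨-, h2, h3⟩ := Ram.leastBelow_spec I.HasWalkOfCost (I.n * I.numCodes + 1)
  set b := I.n * I.numCodes + 1
  by_cases h : ∃ i : Fin b, I.HasWalkOfCost i
  · obtain ⟨i, hi⟩ := h
    have hl := h2 ((h3 i i.2 hi).trans_lt i.2)
    have : I.opt = (Ram.leastBelow I.HasWalkOfCost b : ℕ) := by
      rw [hopt]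
      refine le_antisymm (iInf₂_le (Ram.leastBelow I.HasWalkOfCost b) (hwalk hl))
        (le_iInf₂ fun ℓ hℓ => ?_)
      obtain ⟨m, hm, hm'⟩ := hex hℓ
      exact_mod_cast (h3 m hm'.lt hm').trans hm
    rw [answer, this, Ram.ind_of ⟨i, hi⟩, one_mul]
    rfl
  · have : I.opt = ⊤ := by
      rw [hopt]
      refine iInf₂_eq_top.2 fun ℓ hℓ => ?_
      obtain ⟨m, -, hm⟩ := hex hℓ
      exact (h ⟨⟨m, hm.lt⟩, hm⟩).elim
    rw [answer, this, Ram.ind_of_not h, zero_mul]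
    rfl

end Instance

end ListRecoloring

namespace ListRecoloring

open Ram Ram.Term

/-! ### The algorithm -/

def tVertices : Term := .read (.const 0)

def tColors : Term := .read (.const 1)

def tAdj (u v : Term) : Term := .read (.add (.const 2) (.add (tMul u tVertices) v))

def tMem (c v : Term) : Term :=
  .read (.add (.const 2) (.add (tMul tVertices tVertices) (.add (tMul v tColors) c)))

def tIni (v : Term) : Term :=
  .read (.add (.const 2) (.add (tMul tVertices tVertices) (.add (tMul tVertices tColors) v)))

def tTar (v : Term) : Term :=
  .read (.add (.const 2) (.add (tMul tVertices tVertices) (.add (tMul tVertices tColors)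
    (.add tVertices v))))

def tTwin (u v : Term) : Term :=
  tAnd (tEq (tIni u) (tIni v)) (tAnd (tEq (tTar u) (tTar v))
    (tAnd (tForall tColors (tEq (tMem (.var 0) (lift u)) (tMem (.var 0) (lift v))))
      (tForall tVertices (tEq (tAdj (lift u) (.var 0)) (tAdj (lift v) (.var 0))))))

def tIsRep (v : Term) : Term :=
  tForall tVertices (tImp (tLt (.var 0) (lift v)) (tNot (tTwin (.var 0) (lift v))))

def tNumClasses : Term := tSum tVertices (tIsRep (.var 0))

/-- Each loop binds an index and an accumulator, so `var 2` is the index of the outer loop. -/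
def tClassIdx (v : Term) : Term :=
  tSum tVertices (tAnd (tIsRep (.var 0)) (tForall tVertices
    (tImp (tNot (tLt (.var 2) (.var 0))) (tNot (tTwin (.var 0) (lift (lift v)))))))

def tNumCodes : Term := tPow tColors tNumClasses

def tColor (c v : Term) : Term := tDigit c tColors (tClassIdx v)

def tIsColoring (c : Term) : Term :=
  tAnd (tForall tVertices (tMem (tColor (lift c) (.var 0)) (.var 0)))
    (tForall tVertices (tForall tVertices (tImp (tAdj (.var 2) (.var 0))
      (tNot (tEq (tColor (lift (lift c)) (.var 2)) (tColor (lift (lift c)) (.var 0)))))))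

def tDiffer (c c' v : Term) : Term := tNot (tEq (tColor c v) (tColor c' v))

def tStep (c c' : Term) : Term :=
  tForall tVertices (tForall tVertices (tImp
    (tAnd (tDiffer (lift (lift c)) (lift (lift c')) (.var 2))
      (tDiffer (lift (lift c)) (lift (lift c')) (.var 0)))
    (tTwin (.var 2) (.var 0))))

def tCost (c c' : Term) : Term := tSum tVertices (tDiffer (lift c) (lift c') (.var 0))

def tNumWalks : Term := tPow tNumCodes (.add tNumCodes (.const 1))

def tState (w j : Term) : Term := tDigit w tNumCodes j

def tIsWalk (w : Term) : Term :=
  tAnd (tForall tVertices (tEq (tColor (tState (lift w) (.const 0)) (.var 0)) (tIni (.var 0))))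
    (tAnd (tForall tVertices (tEq (tColor (tState (lift w) tNumCodes) (.var 0)) (tTar (.var 0))))
      (tAnd (tForall (.add tNumCodes (.const 1)) (tIsColoring (tState (lift w) (.var 0))))
        (tForall tNumCodes
          (tStep (tState (lift w) (.var 0)) (tState (lift w) (.add (.var 0) (.const 1)))))))

def tWalkCost (w : Term) : Term :=
  tSum tNumCodes (tCost (tState (lift w) (.var 0)) (tState (lift w) (.add (.var 0) (.const 1))))

def tHasWalkOfCost (l : Term) : Term :=
  tExists tNumWalks (tAnd (tIsWalk (.var 0)) (tEq (tWalkCost (.var 0)) (lift l)))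

def tCostBound : Term := .add (tMul tVertices tNumCodes) (.const 1)

def tAnswer : Term :=
  tMul (tExists tCostBound (tHasWalkOfCost (.var 0)))
    (.add (tLeast tCostBound (tHasWalkOfCost (.var 0))) (.const 1))

/-! ### Correctness of the algorithm -/

theorem getD_append_add {l l' : List ℕ} {m : ℕ} (h : l.length = m) (i : ℕ) :
    (l ++ l').getD (m + i) 0 = l'.getD i 0 := by
  subst h
  rw [List.getD_append_right _ _ _ _ (Nat.le_add_right _ _), Nat.add_sub_cancel_left]

theorem getD_ofFn {m : ℕ} (f : Fin m → ℕ) {i : ℕ} (h : i < m) (l : List ℕ) :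
    (List.ofFn f ++ l).getD i 0 = f ⟨i, h⟩ := by
  rw [List.getD_append _ _ _ _ (by simpa using h), List.getD_eq_getElem _ _ (by simpa using h)]
  simp

/-! ### Layout of the input array -/

namespace Instance

variable (I : Instance)

/-- The input array of an instance. -/
noncomputable def input (i : ℕ) : ℕ := I.encode.getD i 0

variable {I}

theorem row_lt {m n : ℕ} (u : Fin m) (v : Fin n) : (u : ℕ) * n + v < m * n := by
  have h1 : (u : ℕ) * n + v < (u + 1) * n := by rw [Nat.succ_mul]; omega
  exact h1.trans_le (Nat.mul_le_mul_right _ u.2)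

theorem divNat_row {m n : ℕ} (u : Fin m) (v : Fin n) (h : (u : ℕ) * n + v < m * n) :
    (⟨u * n + v, h⟩ : Fin (m * n)).divNat = u := by
  ext
  simp only [Fin.coe_divNat]
  rw [mul_comm, Nat.mul_add_div (Fin.pos v), Nat.div_eq_of_lt v.2, add_zero]

theorem modNat_row {m n : ℕ} (u : Fin m) (v : Fin n) (h : (u : ℕ) * n + v < m * n) :
    (⟨u * n + v, h⟩ : Fin (m * n)).modNat = v := by
  ext
  simp only [Fin.coe_modNat]
  rw [mul_comm, Nat.mul_add_mod, Nat.mod_eq_of_lt v.2]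

theorem input_adj (u v : Fin I.n) : I.input (2 + (u * I.n + v)) = ind (I.graph.Adj u v) := by
  simp only [input, encode, List.append_assoc]
  rw [getD_append_add (m := 2) rfl, getD_ofFn _ (row_lt u v), divNat_row, modNat_row]
  rfl

theorem input_mem (c : Fin I.k) (v : Fin I.n) :
    I.input (2 + (I.n * I.n + (v * I.k + c))) = ind (c ∈ I.list v) := by
  simp only [input, encode, List.append_assoc]
  rw [getD_append_add (m := 2) rfl, getD_append_add (by simp), getD_ofFn _ (row_lt v c), divNat_row,
    modNat_row]
  unfold ind
  congr

theorem input_ini (v : Fin I.n) : I.input (2 + (I.n * I.n + (I.n * I.k + v))) = I.ini v := by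
  simp only [input, encode, List.append_assoc]
  rw [getD_append_add (m := 2) rfl, getD_append_add (by simp), getD_append_add (by simp), getD_ofFn _ v.2]

theorem input_tar (v : Fin I.n) :
    I.input (2 + (I.n * I.n + (I.n * I.k + (I.n + v)))) = I.tar v := by
  simp only [input, encode, List.append_assoc]
  rw [getD_append_add (m := 2) rfl, getD_append_add (by simp), getD_append_add (by simp),
    getD_append_add (by simp), ← List.append_nil (List.ofFn fun v => (I.tar v : ℕ)),
    getD_ofFn _ v.2]

/-- A number that bounds everything that the algorithm counts to. -/
structure Bounded (I : Instance) (B : ℕ) : Prop where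
  vertices : I.n ≤ B
  colors : I.k ≤ B
  codes : I.numCodes + 1 ≤ B
  walks : I.numCodes ^ (I.numCodes + 1) ≤ B
  costs : I.n * I.numCodes + 1 ≤ B

theorem numClasses_le_n : I.numClasses ≤ I.n :=
  calc I.numClasses ≤ ∑ _v : Fin I.n, 1 :=
        Finset.sum_le_sum fun v _ => by unfold ind; split_ifs <;> simp
    _ = _ := by simp

/-- Without colors there are no vertices, hence no classes, and `0 ^ 0 = 1`. Codes of walks thus
have a positive base. -/
theorem numCodes_pos : 0 < I.numCodes := by
  rcases Nat.eq_zero_or_pos I.k with h | h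
  · have : I.numClasses = 0 := by
      have : I.n = 0 := by
        by_contra hn
        have := (I.ini ⟨0, by omega⟩).2
        omega
      have := I.numClasses_le_n
      omega
    rw [numCodes, this, pow_zero]
    exact Nat.one_pos
  · exact pow_pos h _

/-! ### Evaluation of the terms of the algorithm -/

section

variable {B : ℕ} {env : List ℕ} {a b c c' : Term}

theorem computes_vertices : Computes I.input B env tVertices I.n := .read (.const 0)

theorem computes_colors : Computes I.input B env tColors I.k := .read (.const 1)

theorem computes_eq {m : ℕ} {x y : Fin m} (ha : Computes I.input B env a x)
    (hb : Computes I.input B env b y) : Computes I.input B env (tEq a b) (ind (x = y)) :=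
  (Computes.tEq ha hb).of_eq (by rw [Fin.ext_iff])

variable (hB : I.Bounded B)
include hB

theorem computes_adj {u v : Fin I.n} (ha : Computes I.input B env a u)
    (hb : Computes I.input B env b v) :
    Computes I.input B env (tAdj a b) (ind (I.graph.Adj u v)) :=
  input_adj u v ▸ .read (.add (.const 2) (.add
    (.tMul ha computes_vertices (u.2.le.trans hB.vertices)) hb))

theorem computes_mem {x : Fin I.k} {v : Fin I.n} (ha : Computes I.input B env a x)
    (hb : Computes I.input B env b v) : Computes I.input B env (tMem a b) (ind (x ∈ I.list v)) :=
  input_mem x v ▸ .read (.add (.const 2) (.add (.tMul computes_vertices computes_vertices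
    hB.vertices) (.add (.tMul hb computes_colors (v.2.le.trans hB.vertices)) ha)))

theorem computes_ini {v : Fin I.n} (ha : Computes I.input B env a v) :
    Computes I.input B env (tIni a) (I.ini v) :=
  input_ini v ▸ .read (.add (.const 2) (.add (.tMul computes_vertices computes_vertices
    hB.vertices) (.add (.tMul computes_vertices computes_colors hB.vertices) ha)))

theorem computes_tar {v : Fin I.n} (ha : Computes I.input B env a v) :
    Computes I.input B env (tTar a) (I.tar v) :=
  input_tar v ▸ .read (.add (.const 2) (.add (.tMul computes_vertices computes_vertices
    hB.vertices) (.add (.tMul computes_vertices computes_colors hB.vertices)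
      (.add computes_vertices ha))))

theorem computes_twin {u v : Fin I.n} (ha : Computes I.input B env a u)
    (hb : Computes I.input B env b v) : Computes I.input B env (tTwin a b) (ind (I.Twin u v)) :=
  .tAnd (computes_eq (computes_ini hB ha) (computes_ini hB hb))
    (.tAnd (computes_eq (computes_tar hB ha) (computes_tar hB hb))
      (.tAnd
        (.tForall computes_colors hB.colors fun _ _ =>
          .tIff (computes_mem hB .var0 ha.lift) (computes_mem hB .var0 hb.lift))
        (.tForall computes_vertices hB.vertices fun _ _ =>
          .tIff (computes_adj hB ha.lift .var0) (computes_adj hB hb.lift .var0))))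

theorem computes_isRep {v : Fin I.n} (ha : Computes I.input B env a v) :
    Computes I.input B env (tIsRep a) (ind (I.IsRep v)) :=
  .tForall computes_vertices hB.vertices fun _ _ =>
    .tImp (.tLt .var0 ha.lift) (.tNot (computes_twin hB .var0 ha.lift))

theorem computes_numClasses : Computes I.input B env tNumClasses I.numClasses :=
  .tSum computes_vertices hB.vertices fun _ _ => computes_isRep hB .var0

theorem computes_classIdx {v : Fin I.n} (ha : Computes I.input B env a v) :
    Computes I.input B env (tClassIdx a) (I.classIdx v) :=
  .tSum computes_vertices hB.vertices fun _ _ => .tAnd (computes_isRep hB .var0)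
    (.tForall computes_vertices hB.vertices fun _ _ => .tImp (.tNot (.tLt .var2 .var0))
      (.tNot (computes_twin hB .var0 ha.lift.lift)))

theorem computes_numCodes : Computes I.input B env tNumCodes I.numCodes :=
  .tPow computes_colors (computes_numClasses hB) hB.colors (numClasses_le_n.trans hB.vertices)

/-- By definition `finFunctionFinEquiv.symm` returns the digits that `tDigit` computes; the base `k`
is positive because `v` has a color. -/
theorem computes_color {x : Fin I.numCodes} {v : Fin I.n} (hc : Computes I.input B env c x)
    (ha : Computes I.input B env a v) : Computes I.input B env (tColor c a) (color x v) :=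
  .tDigit hc computes_colors (computes_classIdx hB ha)
    (x.2.le.trans ((Nat.le_succ _).trans hB.codes)) hB.colors
    ((classIdx_lt v).le.trans (numClasses_le_n.trans hB.vertices)) (Fin.pos (I.ini v))

theorem computes_isColoring {x : Fin I.numCodes} (hc : Computes I.input B env c x) :
    Computes I.input B env (tIsColoring c) (ind (IsListColoring I.graph I.list (color x))) :=
  .tAnd
    (.tForall computes_vertices hB.vertices fun _ _ =>
      computes_mem hB (computes_color hB hc.lift .var0) .var0)
    (.tForall computes_vertices hB.vertices fun _ _ =>
      .tForall computes_vertices hB.vertices fun _ _ => .tImp (computes_adj hB .var2 .var0)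
        (.tNot (computes_eq (computes_color hB hc.lift.lift .var2)
          (computes_color hB hc.lift.lift .var0))))

theorem computes_differ {x y : Fin I.numCodes} {v : Fin I.n} (hc : Computes I.input B env c x)
    (hc' : Computes I.input B env c' y) (ha : Computes I.input B env a v) :
    Computes I.input B env (tDiffer c c' a) (ind (color x v ≠ color y v)) :=
  .tNot (computes_eq (computes_color hB hc ha) (computes_color hB hc' ha))

theorem computes_step {x y : Fin I.numCodes} (hc : Computes I.input B env c x)
    (hc' : Computes I.input B env c' y) :
    Computes I.input B env (tStep c c') (ind (Step x y)) :=
  .tForall computes_vertices hB.vertices fun _ _ =>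
    .tForall computes_vertices hB.vertices fun _ _ => .tImp
      (.tAnd (computes_differ hB hc.lift.lift hc'.lift.lift .var2)
        (computes_differ hB hc.lift.lift hc'.lift.lift .var0))
      (computes_twin hB .var2 .var0)

theorem computes_cost {x y : Fin I.numCodes} (hc : Computes I.input B env c x)
    (hc' : Computes I.input B env c' y) :
    Computes I.input B env (tCost c c') (cost (color x) (color y)) :=
  .tSum computes_vertices hB.vertices fun _ _ => computes_differ hB hc.lift hc'.lift .var0

theorem computes_numWalks :
    Computes I.input B env tNumWalks (I.numCodes ^ (I.numCodes + 1)) :=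
  .tPow (computes_numCodes hB) (.add (computes_numCodes hB) (.const 1))
    ((Nat.le_succ _).trans hB.codes) hB.codes

theorem computes_state {w : Fin (I.numCodes ^ (I.numCodes + 1))} {j : Fin (I.numCodes + 1)}
    (ha : Computes I.input B env a w) (hb : Computes I.input B env b j) :
    Computes I.input B env (tState a b) (finFunctionFinEquiv.symm w j : Fin I.numCodes) :=
  .tDigit ha (computes_numCodes hB) hb (w.2.le.trans hB.walks) ((Nat.le_succ _).trans hB.codes)
    (j.2.le.trans hB.codes) numCodes_pos

theorem computes_isWalk {w : Fin (I.numCodes ^ (I.numCodes + 1))}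
    (ha : Computes I.input B env a w) :
    Computes I.input B env (tIsWalk a) (ind (IsWalk (I := I) (finFunctionFinEquiv.symm w))) :=
  have hK : I.numCodes ≤ B := (Nat.le_succ _).trans hB.codes
  .tAnd
    (.tForall computes_vertices hB.vertices fun _ _ => computes_eq
      (computes_color hB (computes_state hB (j := 0) ha.lift (.const 0)) .var0)
      (computes_ini hB .var0))
    (.tAnd
      (.tForall computes_vertices hB.vertices fun _ _ => computes_eq
        (computes_color hB (computes_state hB (j := Fin.last _) ha.lift (computes_numCodes hB))
          .var0) (computes_tar hB .var0))
      (.tAnd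
        (.tForall (.add (computes_numCodes hB) (.const 1)) hB.codes fun _ _ =>
          computes_isColoring hB (computes_state hB ha.lift .var0))
        (.tForall (computes_numCodes hB) hK fun j _ => computes_step hB
          (computes_state hB (j := j.castSucc) ha.lift .var0)
          (computes_state hB (j := j.succ) ha.lift (.add .var0 (.const 1))))))

theorem computes_walkCost {w : Fin (I.numCodes ^ (I.numCodes + 1))}
    (ha : Computes I.input B env a w) :
    Computes I.input B env (tWalkCost a) (walkCost (I := I) (finFunctionFinEquiv.symm w)) :=
  .tSum (computes_numCodes hB) ((Nat.le_succ _).trans hB.codes) fun j _ => computes_cost hB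
    (computes_state hB (j := j.castSucc) ha.lift .var0)
    (computes_state hB (j := j.succ) ha.lift (.add .var0 (.const 1)))

theorem computes_hasWalkOfCost {l : ℕ} (ha : Computes I.input B env a l) :
    Computes I.input B env (tHasWalkOfCost a) (ind (I.HasWalkOfCost l)) :=
  .tExists (computes_numWalks hB) hB.walks fun _ _ =>
    .tAnd (computes_isWalk hB .var0) (.tEq (computes_walkCost hB .var0) ha.lift)

theorem computes_answer : Computes I.input B env tAnswer I.answer := by
  rw [answer_eq]
  have hb {env : List ℕ} : Computes I.input B env tCostBound (I.n * I.numCodes + 1) :=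
    .add (.tMul computes_vertices (computes_numCodes hB) hB.vertices) (.const 1)
  refine .tMul (.tExists hb hB.costs fun _ _ => computes_hasWalkOfCost hB .var0)
    (.add (.tLeast hb hB.costs fun _ _ _ => computes_hasWalkOfCost hB .var0) (.const 1)) ?_
  have := hB.codes
  unfold ind
  split_ifs <;> omega

end

end Instance

/-! ### The running time -/

/-- A bound on the number of codes in terms of the parameter. -/
def codeBound (p : ℕ) : ℕ := (p + 1) ^ (p + 2 ^ p * (2 ^ p * (p * p)))

/-- A bound on the number of codes of walks in terms of the parameter. -/
def walkBound (p : ℕ) : ℕ := (codeBound p + 1) ^ (codeBound p + 2)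

theorem primrec_pow {f g : ℕ → ℕ} (hf : Primrec f) (hg : Primrec g) :
    Primrec fun p => f p ^ g p :=
  (Primrec.nat_rec' (f := g) (g := fun _ => 1) (h := fun p q => q.2 * f p) hg (.const 1)
    (Primrec.nat_mul.comp (Primrec.snd.comp .snd) (hf.comp .fst))).of_eq fun p => by
      induction g p with
      | zero => rfl
      | succ m ih => rw [pow_succ, ← ih]

theorem primrec_walkBound : Primrec walkBound := by
  have h2 : Primrec fun p : ℕ => 2 ^ p := primrec_pow (.const 2) .id
  have hK : Primrec codeBound := primrec_pow .succ (Primrec.nat_add.comp .id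
    (Primrec.nat_mul.comp h2 (Primrec.nat_mul.comp h2 (Primrec.nat_mul.comp .id .id))))
  exact primrec_pow (Primrec.succ.comp hK) (Primrec.succ.comp (Primrec.succ.comp hK))

theorem length_le_inputSize (l : List ℕ) : l.length ≤ inputSize l := by
  induction l with
  | nil => simp
  | cons a l ih =>
    simp only [inputSize, List.map_cons, List.sum_cons, List.length_cons] at ih ⊢
    omega

theorem BoundedInstance.numCodes_le (I : BoundedInstance) :
    I.numCodes ≤ codeBound (I.k + I.vc) := by
  have hm := Instance.numClasses_le I.cover_le
  have hk : I.k ≤ I.k + I.vc := Nat.le_add_right _ _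
  have hv : I.vc ≤ I.k + I.vc := Nat.le_add_left _ _
  -- The base is `p + 1` instead of `p` so that it is positive and the exponent can be enlarged.
  refine (Nat.pow_le_pow_left (hk.trans (Nat.le_succ _)) _).trans
    (Nat.pow_le_pow_right (Nat.succ_pos _) (hm.trans ?_))
  gcongr <;> exact one_le_two

theorem BoundedInstance.bounded (I : BoundedInstance) :
    I.toInstance.Bounded (inputSize I.encode * walkBound (I.k + I.vc)) := by
  have hlen : I.n + 2 ≤ inputSize I.encode := by
    refine le_trans ?_ (length_le_inputSize _)
    simp [Instance.encode]
    omega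
  have hK := I.numCodes_le
  have hk : I.k ≤ codeBound (I.k + I.vc) := by
    -- A nonzero parameter makes the exponent in `codeBound` nonzero; for parameter zero there are
    -- no colors.
    have : I.k + I.vc + 1 ≤ codeBound (I.k + I.vc) ∨ I.k + I.vc = 0 := by
      rcases Nat.eq_zero_or_pos (I.k + I.vc) with h | h
      · exact .inr h
      · exact .inl (Nat.le_self_pow (by omega) _)
    omega
  have hW : codeBound (I.k + I.vc) + 1 ≤ walkBound (I.k + I.vc) :=
    Nat.le_self_pow (by omega) _
  set K := codeBound (I.k + I.vc)
  set W := walkBound (I.k + I.vc) with hWdef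
  set N := inputSize I.encode
  have h1 : W ≤ N * W := Nat.le_mul_of_pos_left _ (by omega)
  have h2 : N ≤ N * W := Nat.le_mul_of_pos_right _ (by omega)
  refine ⟨by omega, by omega, by omega, ?_, ?_⟩
  · refine le_trans ?_ h1
    rw [hWdef, walkBound]
    calc I.numCodes ^ (I.numCodes + 1) ≤ (K + 1) ^ (I.numCodes + 1) :=
          Nat.pow_le_pow_left (by omega) _
      _ ≤ (K + 1) ^ (K + 2) := Nat.pow_le_pow_right (by omega) (by omega)
  · calc I.n * I.numCodes + 1 ≤ I.n * W + 1 * W :=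
          Nat.add_le_add (Nat.mul_le_mul_left _ (by omega)) (by omega)
      _ = (I.n + 1) * W := by ring
      _ ≤ N * W := Nat.mul_le_mul_right _ (by omega)

end ListRecoloring

/-- The bound `vc` is not part of the encoding, so the algorithm does not have to know it. -/
theorem theorem2 :
    Ram.FixedParameterTractable
      (fun I : ListRecoloring.BoundedInstance => I.toInstance.encode)
      (fun I => I.toInstance.answer)
      (fun I => I.k + I.vc) := by
  refine ⟨ListRecoloring.tAnswer.compile [] 0,
    fun p => ListRecoloring.tAnswer.cst * ListRecoloring.walkBound p ^ ListRecoloring.tAnswer.deg,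
    ListRecoloring.tAnswer.deg, ?_, fun I => ?_⟩
  · exact (Primrec.nat_mul.comp (.const _)
      (ListRecoloring.primrec_pow ListRecoloring.primrec_walkBound (.const _))).to_comp
  · have hB := I.bounded
    obtain ⟨t, h1, h2⟩ := (ListRecoloring.Instance.computes_answer hB (env := [])).haltsWith
      ((Nat.le_add_left 1 _).trans hB.codes)
    refine ⟨t, h1, h2.trans (le_of_eq ?_)⟩
    -- The iteration bound is input size times `walkBound`, so its power separates into a function
    -- of the parameter and a power of the input size.
    rw [mul_pow]
    ring
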